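/- Let $E_1,\dots,E_n$ be normed spaces and $F$ a Banach space, all over $\mathbb K=\mathbb R$ or $\mathbb C$, and let $\mathcal T$ be a locally convex vector space topology on $F$ that contains the weak topology and is contained in the norm topology of $F$. Let $\widehat\bigotimes_{i=1}^n E_i$ be the completed projective tensor product, that is, the completion of $E_1\otimes\dots\otimes E_n$ in the projective norm $\|z\|=\inf\{\sum_j\|x_1^{(j)}\|\cdots\|x_n^{(j)}\| : z=\sum_j x_1^{(j)}\otimes\dots\otimes x_n^{(j)}\}$. For a bounded $n$-linear map $T:E_1\times\dots\times E_n\to F$ let $\widetilde T:\widehat\bigotimes_{i=1}^n E_i\to F$ be the unique bounded linear map with $\widetilde T(x_1\otimes\dots\otimes x_n)=T(x_1,\dots,x_n)$ for all $x_i\in E_i$. Call $T$ compact with respect to $\mathcal T$ if the $\mathcal T$-closure of $\{T(x_1,\dots,x_n): \|x_i\|<1 \text{ for all } i\}$ is $\mathcal T$-compact, and call $\widetilde T$ compact with respect to $\mathcal T$ if the $\mathcal T$-closure of $\{\widetilde T(z):\|z\|<1\}$ is $\mathcal T$-compact. Then $T$ is compact with respect to $\mathcal T$ if and only if $\widetilde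 T$ is compact with respect to $\mathcal T$. -/

import Mathlib

open scoped TensorProduct

noncomputable section

section Compactness

variable {𝕜 : Type*} [NontriviallyNormedField 𝕜] {F : Type*} [NormedAddCommGroup F]
  [NormedSpace 𝕜 F]

/-- A bounded `n`-linear map from normed spaces `E i` to `F` is compact with respect to a topology
`𝒯` on `F` (which need not be the norm topology) if the `𝒯`-closure of the image of the product of
the open unit balls is `𝒯`-compact. -/
def ContinuousMultilinearMap.IsCompactWith {n : ℕ} {E : Fin n → Type*}
    [∀ i, NormedAddCommGroup (E i)] [∀ i, NormedSpace 𝕜 (E i)]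
    (T : ContinuousMultilinearMap 𝕜 E F) (𝒯 : TopologicalSpace F) : Prop :=
  @IsCompact F 𝒯 (@closure F 𝒯 (T '' {x | ∀ i, x i ∈ Metric.ball (0 : E i) 1}))

/-- The case of one variable: a bounded linear map is compact with respect to `𝒯` if the
`𝒯`-closure of the image of the open unit ball is `𝒯`-compact. -/
def ContinuousLinearMap.IsCompactWith {E : Type*} [NormedAddCommGroup E] [NormedSpace 𝕜 E]
    (T : E →L[𝕜] F) (𝒯 : TopologicalSpace F) : Prop :=
  @IsCompact F 𝒯 (@closure F 𝒯 (T '' Metric.ball (0 : E) 1))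

end Compactness

section Topologies

/-- The norm topology of a normed space. -/
@[reducible]
def normTopology (F : Type*) [NormedAddCommGroup F] : TopologicalSpace F :=
  inferInstance

/-- The weak topology of a normed space, as a topology on the space itself. -/
@[reducible]
def weakTopology (𝕜 F : Type*) [NontriviallyNormedField 𝕜] [NormedAddCommGroup F]
    [NormedSpace 𝕜 F] : TopologicalSpace F :=
  TopologicalSpace.induced (toWeakSpace 𝕜 F) inferInstance

/-- `𝒯` is a locally convex vector space topology on `F` that contains the weak topology and is
contained in the norm topology. (In Mathlib's order on topologies, `s ≤ t` means that every
`t`-open set is `s`-open.) -/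
structure IsBetweenWeakAndNorm (𝕜 : Type*) {F : Type*} [RCLike 𝕜] [NormedAddCommGroup F]
    [NormedSpace 𝕜 F] [NormedSpace ℝ F] (𝒯 : TopologicalSpace F) : Prop where
  isTopologicalAddGroup : @IsTopologicalAddGroup F 𝒯 _
  continuousSMul : @ContinuousSMul 𝕜 F _ _ 𝒯
  locallyConvexSpace : @LocallyConvexSpace ℝ F _ _ _ _ 𝒯
  contains_weak : 𝒯 ≤ weakTopology 𝕜 F
  contained_in_norm : normTopology F ≤ 𝒯

end Topologies

section Projective

variable (𝕜 : Type*) [NontriviallyNormedField 𝕜] {n : ℕ} (E : Fin n → Type*)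
  [∀ i, NormedAddCommGroup (E i)] [∀ i, NormedSpace 𝕜 (E i)]

/-- The completed projective tensor product: the completion of the algebraic tensor product with
respect to the projective (semi)norm, which is Mathlib's norm on `⨂[𝕜] i, E i`. -/
abbrev CompletedProjectiveTensorProduct : Type _ :=
  UniformSpace.Completion (⨂[𝕜] i, E i)

variable {E}

/-- The elementary tensor `x₁ ⊗ ⋯ ⊗ xₙ` in the completed projective tensor product. -/
def ctprod (x : ∀ i, E i) : CompletedProjectiveTensorProduct 𝕜 E :=
  ((PiTensorProduct.tprod 𝕜 x : ⨂[𝕜] i, E i) : UniformSpace.Completion (⨂[𝕜] i, E i))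

variable {𝕜} {F : Type*} [NormedAddCommGroup F] [NormedSpace 𝕜 F] [CompleteSpace F]

/-- The bounded linear map on the completed projective tensor product associated to a bounded
multilinear map. -/
def linearization (T : ContinuousMultilinearMap 𝕜 E F) :
    CompletedProjectiveTensorProduct 𝕜 E →L[𝕜] F :=
  (PiTensorProduct.liftIsometry 𝕜 E F T).extend UniformSpace.Completion.toComplL

theorem linearization_coe (T : ContinuousMultilinearMap 𝕜 E F) (z : ⨂[𝕜] i, E i) :
    linearization T (z : UniformSpace.Completion (⨂[𝕜] i, E i)) =
      PiTensorProduct.lift T.toMultilinearMap z := by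
  have h := ContinuousLinearMap.extend_eq (PiTensorProduct.liftIsometry 𝕜 E F T)
    (e := (UniformSpace.Completion.toComplL : (⨂[𝕜] i, E i) →L[𝕜] _))
    (by simpa using UniformSpace.Completion.denseRange_coe)
    (by simpa using UniformSpace.Completion.isUniformInducing_coe _) z
  simpa [linearization] using h

/-- The linearization takes the required values on elementary tensors ... -/
theorem linearization_ctprod (T : ContinuousMultilinearMap 𝕜 E F) (x : ∀ i, E i) :
    linearization T (ctprod 𝕜 x) = T x := by
  rw [ctprod, linearization_coe]
  simp

/-- ... and it is the only bounded linear map that does. -/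
theorem eq_linearization (T : ContinuousMultilinearMap 𝕜 E F)
    (S : CompletedProjectiveTensorProduct 𝕜 E →L[𝕜] F) (hS : ∀ x, S (ctprod 𝕜 x) = T x) :
    S = linearization T := by
  have h : S.toLinearMap ∘ₗ UniformSpace.Completion.toComplL.toLinearMap =
      (linearization T).toLinearMap ∘ₗ UniformSpace.Completion.toComplL.toLinearMap := by
    ext x
    exact (hS x).trans (linearization_ctprod T x).symm
  ext z
  induction z using UniformSpace.Completion.induction_on with
  | hp => exact isClosed_eq S.continuous (linearization T).continuous
  | ih z => exact LinearMap.congr_fun h z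

end Projective

end

/-! ### Krein's theorem for the weak topology -/

section Krein

open MeasureTheory Filter Topology Set Bornology

variable {F : Type*} [NormedAddCommGroup F] [NormedSpace ℝ F]

/-! The projective unit ball is, up to closure, spanned convexly by scalar multiples of elementary
tensors. So `linearization T` maps it into the norm-closed convex hull `C` of the balanced hull of
the compact set attached to `T` (`linearization_image_ball_subset`). The balanced hull is compact,
being the image of a disc times a compact set; the crux is that `C` is `𝒯`-compact as well.

For the weak topology this is Krein's theorem. A bidual limit point of the convex hull lying outside
the space would produce a triangular matrix of pairings
(`exists_dual_apply_eq_one_of_le_dist_range`), which barycenters and dominated convergence forbid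
(`not_triangular_of_isCompact_toWeakSpace`).

To pass to `𝒯` (`IsCompact.of_subset_closure_convexHull`): `C` is totally bounded, and it is
complete because a `𝒯`-Cauchy filter on `C` has a weak cluster point, to which it converges since
`𝒯` has a base at `0` of sets with weakly closed convex closure.

Conversely, elementary tensors of vectors of norm less than `1` lie in the closed unit ball. -/

/-- A convex combination of values of `p` is the barycenter of a probability measure. -/
theorem exists_probabilityMeasure_integral_eq {X : Type*} [MeasurableSpace X]
    [MeasurableSingletonClass X] (p : X → F) {x : F} (hx : x ∈ convexHull ℝ (range p)) :
    ∃ μ : ProbabilityMeasure X, ∀ l : StrongDual ℝ F, ∫ y, l (p y) ∂(μ : Measure X) = l x := by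
  obtain ⟨ι, _, w, z, hw₀, hw₁, hz, rfl⟩ := mem_convexHull_iff_exists_fintype.1 hx
  choose y hy using hz
  refine ⟨⟨∑ i, ENNReal.ofReal (w i) • Measure.dirac (y i), ⟨?_⟩⟩, fun l ↦ ?_⟩
  · simp [← ENNReal.ofReal_sum_of_nonneg (fun i _ ↦ hw₀ i), hw₁]
  · have hint : ∀ i ∈ Finset.univ, Integrable (fun y ↦ l (p y))
        (ENNReal.ofReal (w i) • Measure.dirac (y i)) := fun i _ ↦
      (integrable_dirac (by simp [enorm_lt_top])).smul_measure ENNReal.ofReal_ne_top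
    simp [integral_finsetSum_measure hint, integral_smul_measure, hy, hw₀]

theorem continuous_dual_toWeakSpace_symm (l : StrongDual ℝ F) :
    Continuous fun y : WeakSpace ℝ F ↦ l ((toWeakSpace ℝ F).symm y) :=
  WeakBilin.eval_continuous (topDualPairing ℝ F).flip l

/-- Mazur: a convex set has the same norm and weak closures. -/
theorem isClosed_preimage_toWeakSpace_symm {s : Set F} (hs : Convex ℝ s) (hc : IsClosed s) :
    IsClosed ((toWeakSpace ℝ F).symm ⁻¹' s) := by
  have h := hs.toWeakSpace_closure ℝ
  rw [hc.closure_eq, LinearEquiv.image_eq_preimage_symm] at h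
  rw [h]
  exact isClosed_closure

instance instT2SpaceWeakSpace : T2Space (WeakSpace ℝ F) :=
  (NormedSpace.isEmbedding_inclusionInDoubleDualWeak ℝ F).t2Space

/-- A weakly compact set is norm bounded. -/
theorem isBounded_of_isCompact_toWeakSpace {K : Set F}
    (hK : IsCompact (toWeakSpace ℝ F '' K)) : IsBounded K := by
  -- Points of `K` act as functionals on the dual, pointwise bounded by weak compactness.
  obtain ⟨C, hC⟩ := banach_steinhaus
    (g := fun x : K ↦ NormedSpace.inclusionInDoubleDual ℝ F x) fun l ↦ by
      obtain ⟨C, hC⟩ := (hK.image (continuous_dual_toWeakSpace_symm l)).isBounded.exists_norm_le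
      exact ⟨C, fun x ↦ hC _ ⟨_, mem_image_of_mem _ x.2, by simp⟩⟩
  refine isBounded_iff_forall_norm_le.2 ⟨C, fun x hx ↦ ?_⟩
  have h := hC ⟨x, hx⟩
  rwa [show ‖NormedSpace.inclusionInDoubleDual ℝ F x‖ = ‖x‖ from
    (NormedSpace.inclusionInDoubleDualLi ℝ).norm_map x] at h

/-- A bounded sequence of functionals that clusters at `0` pointwise along an ultrafilter has,
for a given countable set `D`, a subsequence that tends to `0` pointwise on the closed
span of `D`. -/
theorem exists_subseq_tendsto_zero_on_closure_span {D : Set F} (hD : D.Countable)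
    {h : ℕ → StrongDual ℝ F} {M : ℝ} (hM : ∀ m, ‖h m‖ ≤ M) {V : Filter ℕ} [V.NeBot]
    (hV : V ≤ atTop) (hlim : ∀ y ∈ D, Tendsto (fun m ↦ h m y) V (𝓝 0)) :
    ∃ φ : ℕ → ℕ, ∀ y ∈ (Submodule.span ℝ D).topologicalClosure,
      Tendsto (fun k ↦ h (φ k) y) atTop (𝓝 0) := by
  have : Countable D := hD.to_subtype
  let u : ℕ → D → ℝ := fun m y ↦ h m y
  have hu : Tendsto u V (𝓝 0) := tendsto_pi_nhds.2 fun y ↦ hlim y y.2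
  -- `D → ℝ` is first countable, so a cluster point is the limit of a subsequence.
  have hcl : MapClusterPt 0 atTop u := hu.mapClusterPt.mono hV
  obtain ⟨φ, -, hφ⟩ := hcl.tendsto_subseq
  refine ⟨φ, fun y hy ↦ ?_⟩
  have hequi : Equicontinuous fun k y ↦ h (φ k) y :=
    ((NormedSpace.equicontinuous_TFAE fun k ↦ h (φ k)).out 5 1 rfl rfl).1 ⟨M, fun k ↦ hM _⟩
  have hcld : IsClosed {y | Tendsto (fun k ↦ h (φ k) y) atTop (𝓝 0)} :=
    hequi.isClosed_setOfPred_tendsto (f := fun _ ↦ 0) continuous_const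
  refine closure_minimal (s := (Submodule.span ℝ D : Set F)) (fun z hz ↦ ?_) hcld hy
  simp only [mem_ofPred_eq]
  induction hz using Submodule.span_induction with
  | mem z hz => exact (tendsto_pi_nhds.1 hφ ⟨z, hz⟩)
  | zero => simp
  | add a b _ _ ha hb => simpa using ha.add hb
  | smul c a _ ha => simpa using ha.const_mul c

/-- A sequence in the convex hull of a weakly compact set and a bounded sequence of functionals
cannot pair to a triangular matrix whose entries are `0` below the diagonal and bounded away from
`0` on and above it. -/
theorem not_triangular_of_isCompact_toWeakSpace {K : Set F}
    (hK : IsCompact (toWeakSpace ℝ F '' K)) {x : ℕ → F} (hx : ∀ n, x n ∈ convexHull ℝ K)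
    {f : ℕ → StrongDual ℝ F} {M : ℝ} (hM : ∀ m, ‖f m‖ ≤ M)
    (h0 : ∀ m n, n < m → f m (x n) = 0) {δ : ℝ} (hδ : 0 < δ) (h1 : ∀ m n, m ≤ n → δ ≤ f m (x n)) :
    False := by
  let V : Ultrafilter ℕ := hyperfilter ℕ
  have hV : (V : Filter ℕ) ≤ atTop := Nat.hyperfilter_le_atTop
  -- a pointwise limit of the functionals
  obtain ⟨g, hgM, hg⟩ : ∃ g : StrongDual ℝ F, ‖g‖ ≤ M ∧
      ∀ y, Tendsto (fun m ↦ f m y) V (𝓝 (g y)) := by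
    obtain ⟨g, hg, hfg⟩ := (WeakDual.isCompact_closedBall (0 : StrongDual ℝ F)
      M).ultrafilter_le_nhds' (V.map fun m ↦ StrongDual.toWeakDual (f m))
      (Filter.mem_map.2 <| univ_mem' fun m ↦ by simpa using hM m)
    refine ⟨WeakDual.toStrongDual g, by simpa using hg, fun y ↦ ?_⟩
    exact (WeakDual.eval_continuous y).continuousAt.tendsto.comp hfg
  have hgx : ∀ n, g (x n) = 0 := fun n ↦ tendsto_nhds_unique (hg (x n)) <|
    tendsto_const_nhds.congr' <| hV <| (eventually_gt_atTop n).mono fun m hm ↦ (h0 m n hm).symm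
  -- a countable set carrying all the convex combinations
  have hfin : ∀ n, ∃ t : Finset F, (t : Set F) ⊆ K ∧ x n ∈ convexHull ℝ (t : Set F) := fun n ↦ by
    simpa [convexHull_eq_union_convexHull_finite_subsets K] using hx n
  choose t htK hxt using hfin
  let D : Set F := ⋃ n, (t n : Set F)
  obtain ⟨φ, hφ⟩ := exists_subseq_tendsto_zero_on_closure_span (D := D) (h := fun m ↦ f m - g)
    (M := M + M) (countable_iUnion fun n ↦ (t n).countable_toSet)
    (fun m ↦ (norm_sub_le _ _).trans (add_le_add (hM m) hgM)) hV
    (fun y _ ↦ by simpa using (hg y).sub_const (g y))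
  let L : Submodule ℝ F := (Submodule.span ℝ D).topologicalClosure
  -- Cutting `K` down to the closed span of `D` gives a subsequence converging at every point of
  -- `S`, as dominated convergence requires.
  let S : Set (WeakSpace ℝ F) := toWeakSpace ℝ F '' K ∩ (toWeakSpace ℝ F).symm ⁻¹' L
  have hS : IsCompact S := hK.inter_right
    (isClosed_preimage_toWeakSpace_symm L.convex (Submodule.isClosed_topologicalClosure _))
  have : CompactSpace S := isCompact_iff_compactSpace.1 hS
  let _ : MeasurableSpace S := borel S
  have : BorelSpace S := ⟨rfl⟩
  let p : S → F := fun y ↦ (toWeakSpace ℝ F).symm y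
  have hp : ∀ l : StrongDual ℝ F, Continuous fun y ↦ l (p y) := fun l ↦
    (continuous_dual_toWeakSpace_symm l).comp continuous_subtype_val
  have hDp : D ⊆ range p := fun y hy ↦ by
    obtain ⟨n, hn⟩ := mem_iUnion.1 hy
    exact ⟨⟨toWeakSpace ℝ F y, mem_image_of_mem _ (htK n hn),
      (Submodule.span ℝ D).le_topologicalClosure (Submodule.subset_span hy)⟩, rfl⟩
  have hex : ∀ n, ∃ μ : ProbabilityMeasure S, ∀ l : StrongDual ℝ F,
      ∫ y, l (p y) ∂(μ : Measure S) = l (x n) := fun n ↦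
    exists_probabilityMeasure_integral_eq p
      (convexHull_mono ((subset_iUnion (fun n ↦ (t n : Set F)) n).trans hDp) (hxt n))
  choose μ hμ using hex
  obtain ⟨ν, -, hν⟩ := isCompact_univ.ultrafilter_le_nhds' (V.map μ) univ_mem
  have hν' : Tendsto μ V (𝓝 ν) := hν
  -- For fixed `m`, the integral against `μ n` is `f m (x n) - g (x n) = f m (x n) ≥ δ` as soon as
  -- `n ≥ m`; this passes to the limit `ν`.
  have hint : ∀ m, δ ≤ ∫ y, (f m - g) (p y) ∂(ν : Measure S) := fun m ↦ by
    have hl := ProbabilityMeasure.tendsto_iff_forall_integral_tendsto.1 hν'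
      (BoundedContinuousFunction.mkOfCompact ⟨_, hp (f m - g)⟩)
    refine ge_of_tendsto hl (hV <| (eventually_ge_atTop m).mono fun n hn ↦ ?_)
    simpa [hgx n] using (h1 m n hn).trans_eq (by simpa [hgx n] using (hμ n (f m - g)).symm)
  obtain ⟨R, hR⟩ := (isBounded_of_isCompact_toWeakSpace hK).exists_norm_le
  have hdct : Tendsto (fun k ↦ ∫ y, (f (φ k) - g) (p y) ∂(ν : Measure S)) atTop
      (𝓝 (∫ _, (0 : ℝ) ∂(ν : Measure S))) := by
    refine tendsto_integral_of_dominated_convergence (fun _ ↦ (M + M) * R)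
      (fun k ↦ (hp _).aestronglyMeasurable) (integrable_const _)
      (fun k ↦ .of_forall fun y ↦ ?_) (.of_forall fun y ↦ hφ _ y.2.2)
    obtain ⟨z, hz, hzy⟩ := y.2.1
    have hpy : p y = z := by simp [p, ← hzy]
    rw [hpy]
    exact ((f (φ k) - g).le_opNorm z).trans (mul_le_mul
      ((norm_sub_le _ _).trans (add_le_add (hM _) hgM)) (hR z hz) (norm_nonneg _)
      (by linarith [(norm_nonneg _).trans hgM]))
  have := ge_of_tendsto' hdct fun k ↦ hint (φ k)
  simp at this
  linarith

/-- If `φ` in the bidual has distance at least `ε` from the canonical image of the space, then for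
finitely many vectors there is a functional vanishing on them, of norm at most `ε⁻¹`, on which `φ`
takes the value `1`. -/
theorem exists_dual_apply_eq_one_of_le_dist_range {φ : StrongDual ℝ (StrongDual ℝ F)} {ε : ℝ}
    (hε : 0 < ε) (hφ : ∀ x, ε < ‖φ - NormedSpace.inclusionInDoubleDual ℝ F x‖) (s : Finset F) :
    ∃ f : StrongDual ℝ F, ‖f‖ ≤ ε⁻¹ ∧ φ f = 1 ∧ ∀ x ∈ s, f x = 0 := by
  let J := NormedSpace.inclusionInDoubleDual ℝ F
  let A : Submodule ℝ (StrongDual ℝ F) := ⨅ x : s, LinearMap.ker (J x).toLinearMap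
  have hA : ∀ f, f ∈ A ↔ ∀ x ∈ s, f x = 0 := fun f ↦ by simp [A, J]
  suffices h : ∃ f ∈ A, ε * ‖f‖ < ‖φ f‖ by
    obtain ⟨f, hf, hlt⟩ := h
    have hpos : 0 < ‖φ f‖ := (by positivity : 0 ≤ ε * ‖f‖).trans_lt hlt
    refine ⟨(φ f)⁻¹ • f, ?_, ?_, (hA _).1 (A.smul_mem _ hf)⟩
    · rw [norm_smul, norm_inv, inv_mul_le_iff₀ hpos, ← div_eq_mul_inv, le_div_iff₀ hε]
      linarith
    · simp [inv_mul_cancel₀ (norm_pos_iff.1 hpos)]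
  -- Otherwise `φ` has norm at most `ε` on `A`. A Hahn–Banach extension `ψ` of this restriction
  -- differs from `φ` by a functional vanishing on `A`, that is, by some `J x`; so `φ` is within `ε`
  -- of the canonical image.
  by_contra! hle
  obtain ⟨ψ, hψ, hψn⟩ := _root_.exists_extension_norm_eq A (φ.comp A.subtypeL)
  have hmem : (φ - ψ).toLinearMap ∈
      Submodule.span ℝ (range fun x : s ↦ (J x).toLinearMap) := by
    refine mem_span_of_iInf_ker_le_ker fun f hf ↦ ?_
    have := hψ ⟨f, hf⟩
    simp at this
    simp [this]
  obtain ⟨x, hx⟩ : ∃ x, φ - ψ = J x := by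
    have hsub : Submodule.span ℝ (range fun x : s ↦ (J x).toLinearMap) ≤
        LinearMap.range ((ContinuousLinearMap.coeLM ℝ).comp J.toLinearMap) := by
      rw [Submodule.span_le]
      rintro _ ⟨x, rfl⟩
      exact ⟨x, rfl⟩
    obtain ⟨x, hx⟩ := hsub hmem
    exact ⟨x, ContinuousLinearMap.coe_injective hx.symm⟩
  have h1 : ‖ψ‖ ≤ ε := hψn.trans_le <|
    ContinuousLinearMap.opNorm_le_bound _ hε.le fun f ↦ hle f f.2
  have h2 : φ - J x = ψ := by
    rw [← hx]
    exact sub_sub_cancel φ ψ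
  exact ((hφ x).trans_eq (congrArg norm h2)).not_ge h1

/-- **Krein's theorem**: in a Banach space the closed convex hull of a weakly compact set is weakly
compact. -/
theorem IsCompact.toWeakSpace_closure_convexHull [CompleteSpace F] {K : Set F}
    (hK : IsCompact (toWeakSpace ℝ F '' K)) :
    IsCompact (toWeakSpace ℝ F '' closure (convexHull ℝ K)) := by
  rw [(convex_convexHull ℝ K).toWeakSpace_closure ℝ]
  refine NormedSpace.isCompact_closure_of_isBounded ℝ F _ ?_ fun φ hφ ↦ ?_
  · rw [preimage_image_eq _ (toWeakSpace ℝ F).injective]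
    exact isBounded_convexHull.2 (isBounded_of_isCompact_toWeakSpace hK)
  by_contra hr
  let Φ : StrongDual ℝ (StrongDual ℝ F) := WeakDual.toStrongDual φ
  have hcl : IsClosed (range (NormedSpace.inclusionInDoubleDualLi ℝ (E := F))) :=
    ((NormedSpace.inclusionInDoubleDualLi ℝ (E := F)).isometry.isUniformInducing.isComplete_range
      ).isClosed
  obtain ⟨ε, hε, hd⟩ : ∃ ε > 0, ∀ x, ε < ‖Φ - NormedSpace.inclusionInDoubleDual ℝ F x‖ := by
    have hn : Φ ∉ range (NormedSpace.inclusionInDoubleDualLi ℝ (E := F)) := by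
      rintro ⟨x, hx⟩
      exact hr ⟨toWeakSpace ℝ F x, hx⟩
    have hpos := (hcl.notMem_iff_infDist_pos (range_nonempty _)).1 hn
    refine ⟨_, half_pos hpos, fun x ↦ (half_lt_self hpos).trans_le ?_⟩
    exact (Metric.infDist_le_dist_of_mem (mem_range_self x)).trans_eq
      (dist_eq_norm Φ (NormedSpace.inclusionInDoubleDual ℝ F x))
  -- The new functional kills all earlier points; the new point then approximates `Φ` on the new and
  -- all earlier functionals, where `Φ` is `1`, so they exceed `1 / 2` there.
  obtain ⟨u, hu, hur⟩ := exists_seq_of_forall_finset_exists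
    (fun a : StrongDual ℝ F × F ↦ ‖a.1‖ ≤ ε⁻¹ ∧ Φ a.1 = 1 ∧ a.2 ∈ convexHull ℝ K ∧ 1 / 2 ≤ a.1 a.2)
    (fun a b ↦ b.1 a.2 = 0 ∧ 1 / 2 ≤ a.1 b.2) fun s hs ↦ by
      classical
      obtain ⟨f, hf, hf1, hf0⟩ := exists_dual_apply_eq_one_of_le_dist_range hε hd
        (s.image Prod.snd)
      let s' : Finset (StrongDual ℝ F) := insert f (s.image Prod.fst)
      have hs' : ∀ l ∈ s', Φ l = 1 := by
        simp only [s', Finset.mem_insert, Finset.mem_image]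
        rintro l (rfl | ⟨a, ha, rfl⟩)
        exacts [hf1, (hs a ha).2.1]
      have hopen : IsOpen (⋂ l ∈ s', {ψ : WeakDual ℝ (StrongDual ℝ F) | 1 / 2 < ψ l}) :=
        isOpen_biInter_finset fun l _ ↦ isOpen_lt continuous_const (WeakDual.eval_continuous l)
      obtain ⟨ψ, hψ, ⟨_, ⟨y, hy, rfl⟩, rfl⟩⟩ := mem_closure_iff.1 hφ _ hopen <|
        mem_iInter₂.2 fun l hl ↦ by
          have h : φ l = 1 := hs' l hl
          simp only [mem_ofPred_eq, h]
          norm_num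
      have hψ' : ∀ l ∈ s', 1 / 2 ≤ l y := fun l hl ↦ le_of_lt (mem_iInter₂.1 hψ l hl)
      refine ⟨(f, y), ⟨hf, hf1, hy, hψ' f (Finset.mem_insert_self _ _)⟩, fun a ha ↦
        ⟨hf0 _ (Finset.mem_image_of_mem _ ha),
          hψ' _ (Finset.mem_insert_of_mem (Finset.mem_image_of_mem _ ha))⟩⟩
  refine not_triangular_of_isCompact_toWeakSpace hK (x := fun n ↦ (u n).2) (fun n ↦ (hu n).2.2.1)
    (f := fun n ↦ (u n).1) (fun n ↦ (hu n).1) (fun m n h ↦ (hur n m h).1)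
    (δ := 1 / 2) (by norm_num) fun m n h ↦ ?_
  rcases h.eq_or_lt with rfl | h
  exacts [(hu m).2.2.2, (hur m n h).2]

end Krein

/-! ### Krein's theorem for topologies between weak and norm -/

section ConvexHull

open Filter Topology Set

/-- Let `C` be contained in the closed convex hull of a compact set of a locally convex space.
If `C` is compact in another topology (that of `H`), in which all closed convex sets are closed,
then `C` is compact. -/
theorem IsCompact.of_subset_closure_convexHull {G H : Type*} [AddCommGroup G] [Module ℝ G]
    [TopologicalSpace G] [IsTopologicalAddGroup G] [ContinuousSMul ℝ G] [LocallyConvexSpace ℝ G]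
    [TopologicalSpace H] (e : H ≃ G) (he : ∀ V : Set G, Convex ℝ V → IsClosed V → IsClosed (e ⁻¹' V))
    {K C : Set G} (hK : IsCompact K) (hC : C ⊆ closure (convexHull ℝ K))
    (hCe : IsCompact (e ⁻¹' C)) : IsCompact C := by
  let _ : UniformSpace G := IsTopologicalAddGroup.rightUniformSpace G
  have : IsUniformAddGroup G := isUniformAddGroup_of_addCommGroup
  refine isCompact_iff_totallyBounded_isComplete.2
    ⟨hK.totallyBounded.convexHull.closure.subset hC, fun f hf hfC ↦ ?_⟩
  have hne : (comap e f).NeBot := hf.1.comap_of_surj e.surjective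
  obtain ⟨x, hxC, hx⟩ := hCe (f := comap e f) (le_principal_iff.2
    (preimage_mem_comap (le_principal_iff.1 hfC)))
  refine ⟨e x, hxC, fun N hN ↦ ?_⟩
  have hN0 : (fun z ↦ e x - z) ⁻¹' N ∈ 𝓝 (0 : G) :=
    (continuous_const.sub continuous_id).continuousAt.preimage_mem_nhds (by simpa using hN)
  obtain ⟨W, ⟨hW, hWc⟩, hWN⟩ := (closed_nhds_basis (0 : G)).mem_iff.1 hN0
  obtain ⟨U, hU, hUc, hUW⟩ := (locallyConvexSpace_iff_exists_convex_subset_zero ℝ G).1 ‹_› W hW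
  have hVN : closure U ⊆ (fun z ↦ e x - z) ⁻¹' N := (closure_minimal hUW hWc).trans hWN
  have hV : {p : G × G | p.2 - p.1 ∈ closure U} ∈ uniformity G := by
    rw [uniformity_eq_comap_nhds_zero]
    exact preimage_mem_comap (mem_of_superset hU subset_closure)
  obtain ⟨A, hA, hAV⟩ := (cauchy_iff.1 hf).2 _ hV
  refine mem_of_superset hA fun a ha ↦ ?_
  -- The Cauchy set `A` lies in the translate `a + closure U`, which is closed also for `H` and so
  -- contains the cluster point `x`.
  have hcl : IsClosed (e ⁻¹' ((fun y ↦ y - a) ⁻¹' closure U)) := by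
    refine he _ ?_ (isClosed_closure.preimage (continuous_id.sub continuous_const))
    simpa [sub_eq_add_neg] using hUc.closure.translate_preimage_left (-a)
  have hsub : A ⊆ (fun y ↦ y - a) ⁻¹' closure U := fun b hb ↦ hAV (mk_mem_prod ha hb)
  have hxA : x ∈ e ⁻¹' ((fun y ↦ y - a) ⁻¹' closure U) := by
    rw [← hcl.closure_eq, mem_closure_iff_clusterPt]
    exact hx.mono (le_principal_iff.2 (preimage_mem_comap (mem_of_superset hA hsub)))
  simpa using hVN hxA

/-- If `K` is compact for a locally convex topology (that of `G`) between the weak and the norm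
topology of a Banach space `F`, then so is the norm-closed convex hull of `K`. -/
theorem IsCompact.preimage_closure_convexHull_of_between {F G : Type*} [NormedAddCommGroup F]
    [NormedSpace ℝ F] [CompleteSpace F] [AddCommGroup G] [Module ℝ G] [TopologicalSpace G]
    [IsTopologicalAddGroup G] [ContinuousSMul ℝ G] [LocallyConvexSpace ℝ G] (e : G ≃ₗ[ℝ] F)
    (he : Continuous fun x ↦ toWeakSpace ℝ F (e x)) (he' : Continuous e.symm) {K : Set G}
    (hK : IsCompact K) : IsCompact (e ⁻¹' closure (convexHull ℝ (e '' K))) := by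
  have hKw : IsCompact (toWeakSpace ℝ F '' (e '' K)) := by
    simpa [image_image] using hK.image he
  refine hK.of_subset_closure_convexHull ((toWeakSpace ℝ F).symm.trans e.symm).toEquiv
    (fun V hV hVc ↦ ?_) ?_ ?_
  · exact isClosed_preimage_toWeakSpace_symm (hV.linear_preimage e.symm.toLinearMap)
      (hVc.preimage he')
  · have himg : e.symm '' convexHull ℝ (e '' K) = convexHull ℝ K := by
      rw [← LinearEquiv.coe_coe, LinearMap.image_convexHull]
      simp [image_image]
    rw [← himg, ← LinearEquiv.image_symm_eq_preimage]
    exact image_closure_subset_closure_image he'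
  · have h := hKw.toWeakSpace_closure_convexHull
    rw [LinearEquiv.image_eq_preimage_symm] at h
    convert! h using 1
    ext y
    simp

variable (𝕜 F : Type*) [RCLike 𝕜] [NormedAddCommGroup F] [NormedSpace 𝕜 F]

theorem t2Space_weakTopology : @T2Space F (weakTopology 𝕜 F) := by
  have : T2Space (WeakSpace 𝕜 F) :=
    (NormedSpace.isEmbedding_inclusionInDoubleDualWeak 𝕜 F).t2Space
  exact @T2Space.of_injective_continuous F _ (weakTopology 𝕜 F) _ _ _ (toWeakSpace 𝕜 F).injective
    continuous_induced_dom

/-- Every real functional is the real part of a `𝕜`-linear one. -/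
theorem continuous_toWeakSpace_real_toWeakSpace_symm [NormedSpace ℝ F] [IsScalarTower ℝ 𝕜 F] :
    Continuous fun y : WeakSpace 𝕜 F ↦ toWeakSpace ℝ F ((toWeakSpace 𝕜 F).symm y) := by
  refine WeakBilin.continuous_of_continuous_eval (topDualPairing ℝ F).flip fun l ↦ ?_
  have h : Continuous fun y : WeakSpace 𝕜 F ↦
      (StrongDual.extendRCLike l : StrongDual 𝕜 F) ((toWeakSpace 𝕜 F).symm y) :=
    WeakBilin.eval_continuous (topDualPairing 𝕜 F).flip (StrongDual.extendRCLike l)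
  convert! RCLike.continuous_re.comp h using 1
  ext y
  simp
  rfl

variable {𝕜 F} [NormedSpace ℝ F]

theorem IsBetweenWeakAndNorm.t2Space {𝒯 : TopologicalSpace F} (h𝒯 : IsBetweenWeakAndNorm 𝕜 𝒯) :
    @T2Space F 𝒯 :=
  t2Space_antitone h𝒯.contains_weak (t2Space_weakTopology 𝕜 F)

theorem IsBetweenWeakAndNorm.isCompact_closure_convexHull [IsScalarTower ℝ 𝕜 F] [CompleteSpace F]
    {𝒯 : TopologicalSpace F} (h𝒯 : IsBetweenWeakAndNorm 𝕜 𝒯) {K : Set F}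
    (hK : @IsCompact F 𝒯 K) :
    @IsCompact F 𝒯 (@closure F (normTopology F) (convexHull ℝ K)) := by
  have := h𝒯.continuousSMul
  have hsmul : @ContinuousSMul ℝ F _ _ 𝒯 := IsScalarTower.continuousSMul 𝕜
  have h := @IsCompact.preimage_closure_convexHull_of_between F F _ _ _ _ _ 𝒯
    h𝒯.isTopologicalAddGroup hsmul h𝒯.locallyConvexSpace (LinearEquiv.refl ℝ F)
    ((continuous_toWeakSpace_real_toWeakSpace_symm 𝕜 F).comp
      (continuous_iff_le_induced.2 h𝒯.contains_weak))
    (continuous_id_iff_le.2 h𝒯.contained_in_norm) K hK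
  rw [show LinearEquiv.refl ℝ F '' K = K from image_id K] at h
  exact h

end ConvexHull

/-! ### Unit balls and the projective norm -/

section Projective

open Filter Topology Set Pointwise

theorem List.sum_map_mem_sum_map_smul {ι F : Type*} [AddCommGroup F] [Module ℝ F]
    {C : Set F} (hC : Convex ℝ C) (h0 : (0 : F) ∈ C)
    (w : ι → ℝ) (hw : ∀ i, 0 ≤ w i) (v : ι → F) (hv : ∀ i, v i ∈ w i • C) (l : List ι) :
    (l.map v).sum ∈ (l.map w).sum • C := by
  induction l with
  | nil => exact ⟨0, h0, by simp⟩
  | cons i l ih =>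
    simp only [List.map_cons, List.sum_cons]
    rw [hC.add_smul (hw i) (List.sum_nonneg (by simpa using fun i _ ↦ hw i))]
    exact add_mem_add (hv i) ih

variable {𝕜 : Type*} [RCLike 𝕜] {n : ℕ} {E : Fin n → Type*}
  [∀ i, NormedAddCommGroup (E i)] [∀ i, NormedSpace 𝕜 (E i)]
  {F : Type*} [NormedAddCommGroup F] [NormedSpace 𝕜 F]

/-- The value of a continuous multilinear map on the product of the closed unit balls lies in the
closure of the image of the product of the open unit balls. -/
theorem ContinuousMultilinearMap.apply_mem_closure_image_ball (T : ContinuousMultilinearMap 𝕜 E F)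
    {y : ∀ i, E i} (hy : ∀ i, ‖y i‖ ≤ 1) :
    T y ∈ closure (T '' {x | ∀ i, x i ∈ Metric.ball (0 : E i) 1}) := by
  refine image_closure_subset_closure_image T.cont ⟨y, ?_, rfl⟩
  have h : {x : ∀ i, E i | ∀ i, x i ∈ Metric.ball (0 : E i) 1} =
      univ.pi fun i ↦ Metric.ball (0 : E i) 1 := by
    ext
    simp
  rw [h, closure_pi_set]
  intro i _
  let _ : NormedSpace ℝ (E i) := NormedSpace.restrictScalars ℝ 𝕜 (E i)
  beta_reduce
  rw [closure_ball _ one_ne_zero]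
  simpa using hy i

/-- The closure covers `n = 0`, where the empty product bounds the norm of the tensor only by `1`.
-/
theorem image_ball_subset_closure_linearization [CompleteSpace F]
    (T : ContinuousMultilinearMap 𝕜 E F) :
    T '' {x | ∀ i, x i ∈ Metric.ball (0 : E i) 1} ⊆
      closure (linearization T '' Metric.ball 0 1) := by
  rintro _ ⟨x, hx, rfl⟩
  rw [← linearization_ctprod]
  refine image_closure_subset_closure_image (linearization T).continuous ⟨_, ?_, rfl⟩
  let _ : NormedSpace ℝ (CompletedProjectiveTensorProduct 𝕜 E) := NormedSpace.restrictScalars ℝ 𝕜 _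
  rw [closure_ball _ one_ne_zero, mem_closedBall_zero_iff, ctprod, UniformSpace.Completion.norm_coe]
  exact (PiTensorProduct.projectiveSeminorm_tprod_le x).trans
    (Finset.prod_le_one (fun i _ ↦ norm_nonneg _) fun i _ ↦ (mem_ball_zero_iff.1 (hx i)).le)

variable [NormedSpace ℝ F] [IsScalarTower ℝ 𝕜 F]

/-- A scalar multiple of a value of `T` is a positive multiple, by the product of the norms, of an
element of the balanced hull of any set containing the values on the closed unit balls. -/
theorem ContinuousMultilinearMap.smul_apply_mem_smul (T : ContinuousMultilinearMap 𝕜 E F)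
    {K : Set F} (hK : ∀ y : ∀ i, E i, (∀ i, ‖y i‖ ≤ 1) → T y ∈ K) (c : 𝕜) (x : ∀ i, E i) :
    c • T x ∈ (‖c‖ * ∏ i, ‖x i‖) • (Metric.closedBall (0 : 𝕜) 1 • K) := by
  -- If `x i = 0`, then `‖x i‖⁻¹ = 0` and `y i = 0`, so the rescaling remains valid.
  let y : ∀ i, E i := fun i ↦ ((‖x i‖⁻¹ : ℝ) : 𝕜) • x i
  have hy : ∀ i, ‖y i‖ ≤ 1 := fun i ↦ by
    simp only [y, norm_smul, RCLike.norm_ofReal, abs_inv, abs_norm]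
    exact inv_mul_le_one
  have hxy : x = fun i ↦ ((‖x i‖ : ℝ) : 𝕜) • y i := by
    ext i
    by_cases h : x i = 0
    · simp [h]
    · have : ((‖x i‖ : ℝ) : 𝕜) ≠ 0 := by simpa using h
      simp [y, smul_smul, this]
  have hT : T x = ((∏ i, ‖x i‖ : ℝ) : 𝕜) • T y := by
    conv_lhs => rw [hxy, T.map_smul_univ]
    simp
  refine ⟨(((‖c‖⁻¹ : ℝ) : 𝕜) * c) • T y, smul_mem_smul ?_ (hK y hy), ?_⟩
  · simp only [mem_closedBall_zero_iff, norm_mul, RCLike.norm_ofReal, abs_inv, abs_norm]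
    exact inv_mul_le_one
  · have hc : c = ((‖c‖ : ℝ) : 𝕜) * (((‖c‖⁻¹ : ℝ) : 𝕜) * c) := by
      by_cases h : c = 0
      · simp [h]
      · have : ((‖c‖ : ℝ) : 𝕜) ≠ 0 := by simpa using h
        simp [this]
    conv_rhs => rw [hT, hc]
    dsimp only
    rw [← algebraMap_smul 𝕜 (‖c‖ * ∏ i, ‖x i‖), smul_smul, smul_smul, RCLike.algebraMap_eq_ofReal]
    push_cast
    ring_nf

theorem lift_mem_convexHull_of_norm_lt_one (T : ContinuousMultilinearMap 𝕜 E F)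
    {K : Set F} (hK : ∀ y : ∀ i, E i, (∀ i, ‖y i‖ ≤ 1) → T y ∈ K) {z : ⨂[𝕜] i, E i}
    (hz : ‖z‖ < 1) :
    PiTensorProduct.lift T.toMultilinearMap z ∈
      convexHull ℝ (Metric.closedBall (0 : 𝕜) 1 • K) := by
  -- The zero comes from the scalar, since `T 0` need not vanish when `n = 0`.
  have h0 : (0 : F) ∈ convexHull ℝ (Metric.closedBall (0 : 𝕜) 1 • K) :=
    subset_convexHull _ _ ⟨0, by simp, T 0, hK 0 (by simp), by simp⟩
  have hne : Nonempty (PiTensorProduct.lifts z) := (PiTensorProduct.nonempty_lifts z).to_subtype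
  rw [PiTensorProduct.norm_def] at hz
  -- A representation of `z` of total weight less than `1`: its image is a subconvex combination,
  -- and the missing weight goes to `0`.
  obtain ⟨⟨p, hp⟩, hlt⟩ := exists_lt_of_ciInf_lt hz
  rw [PiTensorProduct.mem_lifts_iff] at hp
  have hsum := List.sum_map_mem_sum_map_smul (convex_convexHull ℝ _) h0
    (fun q : 𝕜 × (∀ i, E i) ↦ ‖q.1‖ * ∏ i, ‖q.2 i‖) (fun q ↦ by positivity)
    (fun q ↦ q.1 • T q.2)
    (fun q ↦ smul_set_mono (subset_convexHull ℝ _) (T.smul_apply_mem_smul hK q.1 q.2)) p.toList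
  have hval : PiTensorProduct.lift T.toMultilinearMap z =
      (p.toList.map fun q ↦ q.1 • T q.2).sum := by
    rw [← hp, map_list_sum, List.map_map]
    congr 2
    ext q
    simp
  obtain ⟨v, hv, hvz⟩ := hsum
  rw [hval, ← hvz]
  exact (convex_convexHull ℝ _).smul_mem_of_zero_mem h0 hv
    ⟨PiTensorProduct.projectiveSeminormAux_nonneg p, hlt.le⟩

variable [CompleteSpace F]

theorem linearization_image_ball_subset (T : ContinuousMultilinearMap 𝕜 E F)
    {K : Set F} (hK : ∀ y : ∀ i, E i, (∀ i, ‖y i‖ ≤ 1) → T y ∈ K) :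
    linearization T '' Metric.ball 0 1 ⊆
      closure (convexHull ℝ (Metric.closedBall (0 : 𝕜) 1 • K)) := by
  rintro _ ⟨z, hz, rfl⟩
  have hd := (UniformSpace.Completion.denseRange_coe (α := ⨂[𝕜] i, E i)).open_subset_closure_inter
    Metric.isOpen_ball hz
  refine closure_mono ?_ (image_closure_subset_closure_image (linearization T).continuous
    ⟨z, hd, rfl⟩)
  rintro _ ⟨_, ⟨hw, w, rfl⟩, rfl⟩
  rw [linearization_coe]
  exact lift_mem_convexHull_of_norm_lt_one T hK (by simpa using hw)

end Projective

theorem IsCompact.closure_of_subset_closure {X : Type*} [TopologicalSpace X] {s t : Set X}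
    (ht : IsCompact (closure t)) (h : s ⊆ closure t) : IsCompact (closure s) :=
  ht.of_isClosed_subset isClosed_closure (closure_minimal h isClosed_closure)

theorem mainTheorem4 {𝕜 : Type*} [RCLike 𝕜] {n : ℕ} {E : Fin n → Type*}
    [∀ i, NormedAddCommGroup (E i)] [∀ i, NormedSpace 𝕜 (E i)]
    {F : Type*} [NormedAddCommGroup F] [NormedSpace 𝕜 F] [CompleteSpace F]
    [NormedSpace ℝ F] [IsScalarTower ℝ 𝕜 F]
    (T : ContinuousMultilinearMap 𝕜 E F)
    (𝒯 : TopologicalSpace F) (h𝒯 : IsBetweenWeakAndNorm 𝕜 𝒯) :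
    T.IsCompactWith 𝒯 ↔ (linearization T).IsCompactWith 𝒯 := by
  have hcl : ∀ s : Set F, @closure F (normTopology F) s ⊆ @closure F 𝒯 s := fun s ↦
    closure.mono h𝒯.contained_in_norm
  constructor
  · intro hT
    have hK := @IsCompact.smul_set 𝕜 F _ 𝒯 _ h𝒯.continuousSMul _ _
      (isCompact_closedBall (0 : 𝕜) 1) hT
    have hC := h𝒯.isCompact_closure_convexHull hK
    have := h𝒯.t2Space
    have hCc := @IsCompact.isClosed F 𝒯 _ _ hC
    refine @IsCompact.closure_of_subset_closure F 𝒯 _ _ (by rwa [hCc.closure_eq])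
      ((linearization_image_ball_subset T fun y hy ↦ ?_).trans (@subset_closure F 𝒯 _))
    exact hcl _ (T.apply_mem_closure_image_ball hy)
  · intro hT
    exact @IsCompact.closure_of_subset_closure F 𝒯 _ _ hT
      ((image_ball_subset_closure_linearization T).trans (hcl _))
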